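/- Let $W_0(\mathbb R)$ be the set of functions $f:\mathbb R\to\mathbb C$ of the form $f(x)=\int_{\mathbb R}e^{ixy}h(y)\,dy$ (for all $x\in\mathbb R$) with $h\in L_1(\mathbb R)$, and let $W_0^*(\mathbb R)$ be the set of those $f\in W_0(\mathbb R)$ whose representing function $h$ satisfies in addition $$\int_0^\infty \operatorname*{ess\,sup}_{|s|\ge t}|h(s)|\,dt<\infty .$$ 1) For every $f\in W_0(\mathbb R)$ there exists an even function $g:\mathbb R\to\mathbb R$, strictly increasing on $[0,\infty)$ with $g(x)\to+\infty$ as $x\to+\infty$ (so that, in particular, $g(|k|)\uparrow+\infty$ as $|k|\to\infty$ over the integers $k$), such that the pointwise product $gf$ belongs to $W_0(\mathbb R)$. In particular, there is a function in $W_0(\mathbb R)$ whose value at every integer $k$ is $g(|k|)f(k)$. 2) For every real sequence $(\varepsilon_k)_{k\ge 0}$ that is monotone decreasing (non-increasing) with $\varepsilon_k\to0$, there exists an even real-valued function $f\in W_0^*(\mathbb R)$ such that $f(k)\ge\varepsilon_k$ for all integers $k\ge0$. -/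

import Mathlib

open MeasureTheory Set Filter Topology

/-- `f` is the Fourier integral of `g`: `f x = ∫ e^{ixy} g y dy` for every real `x`. -/
def IsFourierIntegralOf (f g : ℝ → ℂ) : Prop :=
  ∀ x : ℝ, f x = ∫ y : ℝ, Complex.exp (Complex.I * x * y) * g y

/-- The Wiener algebra `W₀(ℝ)` of Fourier integrals of integrable functions. -/
def WienerW0 : Set (ℝ → ℂ) :=
  {f | ∃ g : ℝ → ℂ, Integrable g ∧ IsFourierIntegralOf f g}

/-- The class `W₀*(ℝ)`: Fourier integrals of integrable functions `g` with
`∫₀^∞ ess sup_{|s| ≥ t} |g s| dt < ∞`. -/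
def WienerW0Star : Set (ℝ → ℂ) :=
  {f | ∃ g : ℝ → ℂ, Integrable g ∧ IsFourierIntegralOf f g ∧
    ∫⁻ t in Ioi (0 : ℝ), essSup (fun s : ℝ => ‖g s‖ₑ) (volume.restrict {s : ℝ | t ≤ |s|}) < ⊤}

/-! Part 1: subtracting from `h` its average over translates by `δ u`, with `u` standard Gaussian,
multiplies `f` by `1 - exp (-(δ x)² / 2)`. As translation is continuous in L¹, the difference tends
to `0` in L¹ as `δ → 0`. Choosing `δ j` with L¹ norms below `2⁻ʲ`, the differences sum to an
integrable function whose Fourier integral is `g f`, with `g = ∑ (1 - exp (-(δ j x)² / 2))`. Every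
term increases from `0` to `1` on `[0, ∞)`, so `g` is unbounded.

Part 2: take `f = ∑ e a_j exp (-x² / R_j²)` with `∑ a_j < ∞`. The `j`-th term is at least `a_j` for
`|x| ≤ R_j`, and every `ε k` is at most some `a_j` with `k ≤ R_j`. The representing functions are
Gaussians decreasing in `|y|`, so the essential supremum over `|s| ≥ t` costs no more than the value
at `t`. -/

theorem integrable_tsum_of_summable_integral_norm {α E ι : Type*} [MeasurableSpace α]
    {μ : Measure α} [NormedAddCommGroup E] [CompleteSpace E] [Countable ι]
    {h : ι → α → E} (hi : ∀ i, Integrable (h i) μ)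
    (hs : Summable fun i => ∫ a, ‖h i a‖ ∂μ) :
    Integrable (fun a => ∑' i, h i a) μ := by
  have key : ∑' i, eLpNorm (h i) 1 μ ≠ ⊤ := by
    have (i : ι) : eLpNorm (h i) 1 μ = ENNReal.ofReal (∫ a, ‖h i a‖ ∂μ) := by
      rw [eLpNorm_one_eq_lintegral_enorm, ofReal_integral_norm_eq_lintegral_enorm (hi i)]
    simp_rw [this]
    exact hs.tsum_ofReal_ne_top
  have hae := summable_norm_of_tsum_eLpNorm_ne_top le_rfl (fun i => (hi i).1) key
  have hmeas : AEStronglyMeasurable (fun a => ∑' i, h i a) μ := by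
    refine aestronglyMeasurable_of_tendsto_ae (atTop : Filter (Finset ι))
      (f := fun s a => ∑ i ∈ s, h i a) ?_ ?_
    · intro s
      exact Finset.aestronglyMeasurable_fun_sum s fun i _ => (hi i).1
    · filter_upwards [hae] with a ha
      exact ha.of_norm.hasSum
  refine ⟨hmeas, ?_⟩
  calc ∫⁻ a, ‖∑' i, h i a‖ₑ ∂μ ≤ ∫⁻ a, ∑' i, ‖h i a‖ₑ ∂μ :=
        lintegral_mono fun a => enorm_tsum_le_tsum_enorm
    _ = ∑' i, ∫⁻ a, ‖h i a‖ₑ ∂μ := lintegral_tsum fun i => (hi i).1.enorm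
    _ < ⊤ := by simpa only [eLpNorm_one_eq_lintegral_enorm] using key.lt_top

theorem norm_exp_I_mul_ofReal_mul (x y : ℝ) (z : ℂ) :
    ‖Complex.exp (Complex.I * x * y) * z‖ = ‖z‖ := by
  have : Complex.I * x * y = ((x * y : ℝ) : ℂ) * Complex.I := by push_cast; ring
  rw [norm_mul, this, Complex.norm_exp_ofReal_mul_I, one_mul]

theorem integrable_exp_I_mul {h : ℝ → ℂ} (hh : Integrable h) (x : ℝ) :
    Integrable fun y : ℝ => Complex.exp (Complex.I * x * y) * h y := by
  refine hh.mono ?_ (ae_of_all _ fun y => (norm_exp_I_mul_ofReal_mul x y (h y)).le)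
  exact (by fun_prop : Continuous fun y : ℝ =>
    Complex.exp (Complex.I * x * y)).aestronglyMeasurable.mul hh.1

theorem IsFourierIntegralOf.tsum {ι : Type*} [Countable ι] {f h : ι → ℝ → ℂ}
    (hf : ∀ i, IsFourierIntegralOf (f i) (h i)) (hi : ∀ i, Integrable (h i))
    (hs : Summable fun i => ∫ y, ‖h i y‖) :
    IsFourierIntegralOf (fun x => ∑' i, f i x) (fun y => ∑' i, h i y) := by
  intro x
  have := integral_tsum_of_summable_integral_norm (μ := volume)
    (F := fun i (y : ℝ) => Complex.exp (Complex.I * x * y) * h i y)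
    (fun i => integrable_exp_I_mul (hi i) x)
    (by simpa only [norm_exp_I_mul_ofReal_mul] using hs)
  simp only [tsum_mul_left] at this
  simpa only [← hf _ x] using this

/-! ### Translations in L¹ and averaged differences -/

/-- Strong measurability makes `(y, u) ↦ h (y - δ * u)` jointly measurable, as Fubini requires. -/
theorem exists_stronglyMeasurable_of_mem_WienerW0 {f : ℝ → ℂ} (hf : f ∈ WienerW0) :
    ∃ h : ℝ → ℂ, StronglyMeasurable h ∧ Integrable h ∧ IsFourierIntegralOf f h := by
  obtain ⟨h, hi, hF⟩ := hf
  refine ⟨hi.1.mk h, hi.1.stronglyMeasurable_mk, hi.congr hi.1.ae_eq_mk, fun x => ?_⟩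
  rw [hF x]
  refine integral_congr_ae ?_
  filter_upwards [hi.1.ae_eq_mk] with y hy
  rw [← hy]

theorem tendsto_integral_norm_sub_translate {h : ℝ → ℂ} (hi : Integrable h) :
    Tendsto (fun s : ℝ => ∫ y, ‖h y - h (y - s)‖) (𝓝 0) (𝓝 0) := by
  set F : Lp ℂ 1 (volume : Measure ℝ) := hi.toL1 h with hF
  let g : ℝ → C(ℝ, ℝ) := fun s => ⟨fun y => y - s, by fun_prop⟩
  have hg : Continuous g :=
    ContinuousMap.continuous_of_continuous_uncurry _ (by
      change Continuous fun p : ℝ × ℝ => p.2 - p.1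
      fun_prop)
  have hgm (s : ℝ) : MeasurePreserving (g s) volume volume :=
    measurePreserving_sub_right volume s
  have hc : Continuous fun s : ℝ => Lp.compMeasurePreserving (g s) (hgm s) F :=
    continuous_const.compMeasurePreservingLp hg hgm ENNReal.one_ne_top
  have h0 : Lp.compMeasurePreserving (g 0) (hgm 0) F = F := by
    apply Lp.ext
    filter_upwards [Lp.coeFn_compMeasurePreserving F (hgm 0)] with y hy
    rw [hy]
    simp [g]
  have hn : Continuous fun s : ℝ => ‖F - Lp.compMeasurePreserving (g s) (hgm s) F‖ := by
    fun_prop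
  have ht := hn.tendsto 0
  rw [h0, sub_self, norm_zero] at ht
  refine ht.congr fun s => ?_
  rw [L1.norm_eq_integral_norm]
  refine integral_congr_ae ?_
  filter_upwards [Lp.coeFn_sub F (Lp.compMeasurePreserving (g s) (hgm s) F),
    Lp.coeFn_compMeasurePreserving F (hgm s), hi.coeFn_toL1,
    (hgm s).quasiMeasurePreserving.ae_eq_comp hi.coeFn_toL1] with y h1 h2 h3 h4
  rw [h1, Pi.sub_apply, h2, h4, h3]
  rfl

theorem integral_norm_sub_translate_le {h : ℝ → ℂ} (hi : Integrable h) (s : ℝ) :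
    ∫ y, ‖h y - h (y - s)‖ ≤ 2 * ∫ y, ‖h y‖ := by
  calc ∫ y, ‖h y - h (y - s)‖ ≤ ∫ y, (‖h y‖ + ‖h (y - s)‖) :=
        integral_mono (hi.sub (hi.comp_sub_right s)).norm
          (hi.norm.add (hi.comp_sub_right s).norm) fun y => norm_sub_le _ _
    _ = 2 * ∫ y, ‖h y‖ := by
        rw [integral_add hi.norm (hi.comp_sub_right s).norm,
          integral_sub_right_eq_self (fun y => ‖h y‖) s]
        ring

/-- The difference between `h` and its average over translates by `δ u`, `u` distributed
according to `μ`. -/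
noncomputable def averagedDifference (μ : Measure ℝ) (h : ℝ → ℂ) (δ : ℝ) : ℝ → ℂ :=
  fun y => ∫ u, (h y - h (y - δ * u)) ∂μ

section averagedDifference

variable {μ : Measure ℝ} [IsProbabilityMeasure μ] {h : ℝ → ℂ}

theorem integrable_integral_norm_sub_translate (hm : StronglyMeasurable h) (hi : Integrable h)
    (δ : ℝ) : Integrable (fun u => ∫ y, ‖h y - h (y - δ * u)‖) μ := by
  have hF : StronglyMeasurable fun p : ℝ × ℝ => h p.1 - h (p.1 - δ * p.2) :=
    (hm.comp_measurable measurable_fst).sub (hm.comp_measurable (by fun_prop))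
  refine Integrable.of_bound (C := 2 * ∫ y, ‖h y‖) ?_ (ae_of_all _ fun u => ?_)
  · exact hF.norm.integral_prod_left.aestronglyMeasurable
  · rw [Real.norm_of_nonneg (by positivity)]
    exact integral_norm_sub_translate_le hi _

theorem integrable_prod_sub_translate (hm : StronglyMeasurable h) (hi : Integrable h) (δ : ℝ) :
    Integrable (fun p : ℝ × ℝ => h p.1 - h (p.1 - δ * p.2)) (volume.prod μ) := by
  have hF : StronglyMeasurable fun p : ℝ × ℝ => h p.1 - h (p.1 - δ * p.2) :=
    (hm.comp_measurable measurable_fst).sub (hm.comp_measurable (by fun_prop))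
  rw [integrable_prod_iff' hF.aestronglyMeasurable]
  exact ⟨ae_of_all _ fun u => hi.sub (hi.comp_sub_right (δ * u)),
    integrable_integral_norm_sub_translate hm hi δ⟩

theorem integrable_averagedDifference (hm : StronglyMeasurable h) (hi : Integrable h) (δ : ℝ) :
    Integrable (averagedDifference μ h δ) :=
  (integrable_prod_sub_translate hm hi δ).integral_prod_left

theorem integral_norm_averagedDifference_le (hm : StronglyMeasurable h) (hi : Integrable h)
    (δ : ℝ) : ∫ y, ‖averagedDifference μ h δ y‖ ≤ ∫ u, (∫ y, ‖h y - h (y - δ * u)‖) ∂μ := by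
  have hp := integrable_prod_sub_translate (μ := μ) hm hi δ
  rw [← integral_integral_swap (f := fun y u => ‖h y - h (y - δ * u)‖) hp.norm]
  exact integral_mono (integrable_averagedDifference hm hi δ).norm hp.norm.integral_prod_left
    fun y => norm_integral_le_integral_norm _

theorem tendsto_integral_norm_averagedDifference (hm : StronglyMeasurable h)
    (hi : Integrable h) :
    Tendsto (fun δ => ∫ y, ‖averagedDifference μ h δ y‖) (𝓝 0) (𝓝 0) := by
  have : Tendsto (fun δ => ∫ u, (∫ y, ‖h y - h (y - δ * u)‖) ∂μ) (𝓝 0) (𝓝 (∫ _, (0 : ℝ) ∂μ)) := by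
    refine tendsto_integral_filter_of_norm_le_const (.of_forall fun δ =>
      (integrable_integral_norm_sub_translate hm hi δ).1) ⟨2 * ∫ y, ‖h y‖, .of_forall fun δ =>
        ae_of_all _ fun u => ?_⟩ (ae_of_all _ fun u => ?_)
    · rw [Real.norm_of_nonneg (by positivity)]
      exact integral_norm_sub_translate_le hi _
    · refine (tendsto_integral_norm_sub_translate hi).comp ?_
      exact (by fun_prop : Continuous fun δ : ℝ => δ * u).tendsto' 0 0 (zero_mul u)
  rw [integral_zero] at this
  exact squeeze_zero (fun δ => by positivity)
    (fun δ => integral_norm_averagedDifference_le hm hi δ) this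

/-- Translating `h` by `δ u` multiplies `f x` by `exp (i δ u x)`; Fubini then averages this factor
over `u`. -/
theorem IsFourierIntegralOf.averagedDifference {f : ℝ → ℂ} (hf : IsFourierIntegralOf f h)
    (hm : StronglyMeasurable h) (hi : Integrable h) (δ : ℝ) :
    IsFourierIntegralOf (fun x => (1 - charFun μ (δ * x)) * f x)
      (averagedDifference μ h δ) := by
  intro x
  have hp := integrable_prod_sub_translate (μ := μ) hm hi δ
  have hpe : Integrable (Function.uncurry fun y u : ℝ =>
      Complex.exp (Complex.I * x * y) * (h y - h (y - δ * u))) (volume.prod μ) := by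
    refine hp.mono ?_ (ae_of_all _ fun p => (norm_exp_I_mul_ofReal_mul x p.1 _).le)
    exact (by fun_prop : Continuous fun p : ℝ × ℝ =>
      Complex.exp (Complex.I * x * p.1)).aestronglyMeasurable.mul hp.1
  have hshift (u : ℝ) : ∫ y : ℝ, Complex.exp (Complex.I * x * y) * (h y - h (y - δ * u)) =
      (1 - Complex.exp (u * (δ * x : ℝ) * Complex.I)) * f x := by
    have h1 : ∫ y : ℝ, Complex.exp (Complex.I * x * y) * h (y - δ * u) =
        Complex.exp (u * (δ * x : ℝ) * Complex.I) * f x := by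
      rw [← integral_add_right_eq_self _ (δ * u), hf x, ← integral_const_mul]
      refine integral_congr_ae (ae_of_all _ fun y => ?_)
      simp only [add_sub_cancel_right]
      rw [← mul_assoc, ← Complex.exp_add]
      congr 2
      push_cast
      ring
    simp only [mul_sub]
    rw [integral_sub (integrable_exp_I_mul hi x)
      (integrable_exp_I_mul (hi.comp_sub_right (δ * u)) x), h1, ← hf x]
    ring
  have hint : Integrable (fun u : ℝ => Complex.exp (u * (δ * x : ℝ) * Complex.I)) μ := by
    refine Integrable.of_bound (C := 1) (by fun_prop) (ae_of_all _ fun u => ?_)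
    rw [← Complex.ofReal_mul, Complex.norm_exp_ofReal_mul_I]
  calc (1 - charFun μ (δ * x)) * f x
      = ∫ u, (1 - Complex.exp (u * (δ * x : ℝ) * Complex.I)) * f x ∂μ := by
        rw [integral_mul_const, integral_sub (integrable_const _) hint, charFun_apply_real]
        simp [mul_comm]
    _ = ∫ u, (∫ y : ℝ, Complex.exp (Complex.I * x * y) * (h y - h (y - δ * u))) ∂μ := by
        simp only [hshift]
    _ = ∫ y : ℝ, ∫ u, Complex.exp (Complex.I * x * y) * (h y - h (y - δ * u)) ∂μ :=
        (integral_integral_swap hpe).symm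
    _ = _ := by simp only [integral_const_mul, _root_.averagedDifference]

end averagedDifference

/-! ### The Gaussian multiplier and part 1 -/

theorem charFun_gaussianReal_zero_one (t : ℝ) :
    charFun (ProbabilityTheory.gaussianReal 0 1) t = (Real.exp (-(t ^ 2 / 2)) : ℂ) := by
  rw [ProbabilityTheory.charFun_gaussianReal]
  push_cast
  congr 1
  simp

/-- The series `∑ (1 - exp (-(δ_j x)² / 2))`, the Fourier multiplier of a sum of averaged
differences against the standard Gaussian. -/
noncomputable def gaussianDefect (δ : ℕ → ℝ) (x : ℝ) : ℝ :=
  ∑' j, (1 - Real.exp (-((δ j * x) ^ 2 / 2)))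

section gaussianDefect

variable {δ : ℕ → ℝ}

theorem one_sub_exp_neg_sq_nonneg (t : ℝ) : 0 ≤ 1 - Real.exp (-(t ^ 2 / 2)) :=
  sub_nonneg.2 (Real.exp_le_one_iff.2 (neg_nonpos.2 (by positivity)))

theorem summable_gaussianDefect (hs : Summable fun j => δ j ^ 2) (x : ℝ) :
    Summable fun j => 1 - Real.exp (-((δ j * x) ^ 2 / 2)) := by
  refine (hs.mul_right (x ^ 2 / 2)).of_nonneg_of_le
    (fun j => one_sub_exp_neg_sq_nonneg _) fun j => ?_
  have := Real.add_one_le_exp (-((δ j * x) ^ 2 / 2))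
  have h2 : (δ j * x) ^ 2 / 2 = δ j ^ 2 * (x ^ 2 / 2) := by ring
  linarith

theorem even_gaussianDefect : Function.Even (gaussianDefect δ) := fun x => by
  simp [gaussianDefect]

theorem strictMonoOn_gaussianDefect (h0 : ∀ j, 0 < δ j) (hs : Summable fun j => δ j ^ 2) :
    StrictMonoOn (gaussianDefect δ) (Ici 0) := by
  intro x hx y hy hxy
  have hx' : 0 ≤ x := hx
  have hterm (j : ℕ) : 1 - Real.exp (-((δ j * x) ^ 2 / 2)) <
      1 - Real.exp (-((δ j * y) ^ 2 / 2)) := by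
    have h1 : δ j * x < δ j * y := mul_lt_mul_of_pos_left hxy (h0 j)
    have h2 : (δ j * x) ^ 2 < (δ j * y) ^ 2 :=
      pow_lt_pow_left₀ h1 (mul_nonneg (h0 j).le hx') two_ne_zero
    gcongr
  exact (summable_gaussianDefect hs x).tsum_lt_tsum (i := 0) (fun j => (hterm j).le) (hterm 0)
    (summable_gaussianDefect hs y)

theorem tendsto_gaussianDefect_atTop (h0 : ∀ j, 0 < δ j) (hs : Summable fun j => δ j ^ 2) :
    Tendsto (gaussianDefect δ) atTop atTop := by
  have hterm (j : ℕ) :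
      Tendsto (fun x => 1 - Real.exp (-((δ j * x) ^ 2 / 2))) atTop (𝓝 1) := by
    have h1 : Tendsto (fun x => (δ j * x) ^ 2 / 2) atTop atTop :=
      ((tendsto_pow_atTop two_ne_zero).comp (tendsto_id.const_mul_atTop (h0 j))).atTop_div_const
        two_pos
    simpa using (Real.tendsto_exp_neg_atTop_nhds_zero.comp h1).const_sub 1
  refine tendsto_atTop.2 fun M => ?_
  obtain ⟨N, hN⟩ := exists_nat_gt M
  have hsum : Tendsto (fun x => ∑ j ∈ Finset.range N, (1 - Real.exp (-((δ j * x) ^ 2 / 2))))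
      atTop (𝓝 N) := by
    simpa using tendsto_finsetSum (Finset.range N) fun j _ => hterm j
  filter_upwards [hsum.eventually_const_lt hN] with x hx
  exact hx.le.trans ((summable_gaussianDefect hs x).sum_le_tsum _
    fun j _ => one_sub_exp_neg_sq_nonneg _)

end gaussianDefect

theorem exists_even_strictMonoOn_mul_mem_WienerW0 {f : ℝ → ℂ} (hf : f ∈ WienerW0) :
    ∃ g : ℝ → ℝ, Function.Even g ∧ StrictMonoOn g (Ici 0) ∧ Tendsto g atTop atTop ∧
      (fun x : ℝ => (g x : ℂ) * f x) ∈ WienerW0 := by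
  obtain ⟨h, hm, hi, hF⟩ := exists_stronglyMeasurable_of_mem_WienerW0 hf
  let μ := ProbabilityTheory.gaussianReal 0 1
  -- The bound on `δ` makes the series for `g` converge; the bound on the norm makes the differences
  -- summable in L¹.
  have hex (j : ℕ) : ∃ δ : ℝ, 0 < δ ∧ δ < (1 / 2) ^ j ∧
      ∫ y, ‖averagedDifference μ h δ y‖ < (1 / 2) ^ j := by
    have hpos : (0 : ℝ) < (1 / 2) ^ j := by positivity
    have h1 := (tendsto_integral_norm_averagedDifference (μ := μ) hm hi).eventually_lt_const hpos
    have h2 : ∀ᶠ δ : ℝ in 𝓝[>] 0, 0 < δ := self_mem_nhdsWithin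
    exact (h2.and (((eventually_lt_nhds hpos).and h1).filter_mono nhdsWithin_le_nhds)).exists
  choose δ h0 hδ hn using hex
  have hs : Summable fun j => δ j ^ 2 := by
    refine (summable_geometric_two).of_nonneg_of_le (fun j => sq_nonneg _) fun j => ?_
    have h1 : δ j ≤ 1 := (hδ j).le.trans (pow_le_one₀ (by norm_num) (by norm_num))
    exact (pow_le_of_le_one (h0 j).le h1 two_ne_zero).trans (hδ j).le
  have hns : Summable fun j => ∫ y, ‖averagedDifference μ h (δ j) y‖ :=
    summable_geometric_two.of_nonneg_of_le (fun j => by positivity) fun j => (hn j).le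
  have hint (j : ℕ) := integrable_averagedDifference (μ := μ) hm hi (δ j)
  refine ⟨gaussianDefect δ, even_gaussianDefect, strictMonoOn_gaussianDefect h0 hs,
    tendsto_gaussianDefect_atTop h0 hs, _, integrable_tsum_of_summable_integral_norm hint hns, ?_⟩
  have := IsFourierIntegralOf.tsum (fun j => hF.averagedDifference (μ := μ) hm hi (δ j)) hint hns
  convert this using 2 with x
  rw [tsum_mul_right, gaussianDefect, Complex.ofReal_tsum]
  simp only [μ, charFun_gaussianReal_zero_one, Complex.ofReal_sub, Complex.ofReal_one]

/-! ### Sums of Gaussians and part 2 -/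

/-- By radial monotonicity the essential supremum is at most `∑ ‖h i t‖`, whose integral is at most
the sum of the L¹ norms. -/
theorem tsum_mem_WienerW0Star {ι : Type*} [Countable ι] {f h : ι → ℝ → ℂ}
    (hf : ∀ i, IsFourierIntegralOf (f i) (h i)) (hi : ∀ i, Integrable (h i))
    (hs : Summable fun i => ∫ y, ‖h i y‖)
    (hanti : ∀ i (t s : ℝ), |t| ≤ |s| → ‖h i s‖ ≤ ‖h i t‖) :
    (fun x => ∑' i, f i x) ∈ WienerW0Star := by
  refine ⟨_, integrable_tsum_of_summable_integral_norm hi hs, IsFourierIntegralOf.tsum hf hi hs, ?_⟩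
  have hess (t : ℝ) (ht : 0 < t) :
      essSup (fun s : ℝ => ‖∑' i, h i s‖ₑ) (volume.restrict {s : ℝ | t ≤ |s|}) ≤
        ∑' i, ‖h i t‖ₑ := by
    refine essSup_le_of_ae_le _ (ae_restrict_of_forall_mem
      (measurableSet_le measurable_const measurable_id.abs) fun s hts => ?_)
    refine enorm_tsum_le_tsum_enorm.trans (ENNReal.tsum_le_tsum fun i => ?_)
    refine enorm_le_iff_norm_le.2 (hanti i t s ?_)
    rwa [abs_of_pos ht]
  calc _ ≤ ∫⁻ t in Ioi (0 : ℝ), ∑' i, ‖h i t‖ₑ :=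
        setLIntegral_mono' measurableSet_Ioi hess
    _ ≤ ∫⁻ t, ∑' i, ‖h i t‖ₑ := setLIntegral_le_lintegral _ _
    _ = ∑' i, ENNReal.ofReal (∫ t, ‖h i t‖) := by
        rw [lintegral_tsum fun i => (hi i).1.enorm]
        simp only [ofReal_integral_norm_eq_lintegral_enorm (hi _)]
    _ < ⊤ := hs.tsum_ofReal_lt_top

/-- The Gaussian density of total mass `a` and inverse width parameter `b`. -/
noncomputable def gaussianKernel (a b y : ℝ) : ℝ :=
  a * (√(b / Real.pi) * Real.exp (-b * y ^ 2))

section gaussianKernel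

variable {a b : ℝ}

theorem gaussianKernel_nonneg (ha : 0 ≤ a) (y : ℝ) : 0 ≤ gaussianKernel a b y := by
  unfold gaussianKernel
  positivity

theorem integrable_gaussianKernel (hb : 0 < b) : Integrable (gaussianKernel a b) :=
  ((integrable_exp_neg_mul_sq hb).const_mul _).const_mul _

theorem integral_gaussianKernel (hb : 0 < b) : ∫ y, gaussianKernel a b y = a := by
  simp only [gaussianKernel]
  rw [integral_const_mul, integral_const_mul, integral_gaussian, ← Real.sqrt_mul (by positivity)]
  have := Real.pi_pos
  rw [show b / Real.pi * (Real.pi / b) = 1 by field_simp, Real.sqrt_one, mul_one]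

theorem gaussianKernel_le_of_abs_le (ha : 0 ≤ a) (hb : 0 < b) {t s : ℝ} (hts : |t| ≤ |s|) :
    gaussianKernel a b s ≤ gaussianKernel a b t := by
  have := sq_le_sq.2 hts
  unfold gaussianKernel
  gcongr a * (_ * Real.exp ?_)
  nlinarith

theorem isFourierIntegralOf_gaussianKernel (hb : 0 < b) :
    IsFourierIntegralOf (fun x => ((a * Real.exp (-x ^ 2 / (4 * b)) : ℝ) : ℂ))
      (fun y => (gaussianKernel a b y : ℂ)) := by
  intro x
  have hG := fourierIntegral_gaussian (b := b) (by simpa using hb) x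
  have hroot : ((Real.pi : ℂ) / b) ^ (1 / 2 : ℂ) = ((√(Real.pi / b) : ℝ) : ℂ) := by
    rw [Real.sqrt_eq_rpow, Complex.ofReal_cpow (by positivity)]
    push_cast
    rfl
  have hone : √(b / Real.pi) * √(Real.pi / b) = 1 := by
    have := Real.pi_pos
    rw [← Real.sqrt_mul (by positivity), show b / Real.pi * (Real.pi / b) = 1 by field_simp,
      Real.sqrt_one]
  have hpt (y : ℝ) : Complex.exp (Complex.I * x * y) * (gaussianKernel a b y : ℂ) =
      ((a * √(b / Real.pi) : ℝ) : ℂ) *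
        (Complex.exp (Complex.I * x * y) * Complex.exp (-b * y ^ 2)) := by
    simp only [gaussianKernel]
    push_cast
    ring
  simp only [hpt]
  rw [integral_const_mul, hG, hroot, ← mul_assoc, ← Complex.ofReal_mul, mul_assoc, hone, mul_one]
  push_cast
  rfl

end gaussianKernel

theorem exists_summable_dominating {ε : ℕ → ℝ} (hε : Antitone ε) (hlim : Tendsto ε atTop (𝓝 0)) :
    ∃ a R : ℕ → ℝ, Summable a ∧ (∀ j, 0 ≤ a j) ∧ (∀ j, 0 < R j) ∧
      ∀ k : ℕ, ∃ j, (k : ℝ) ≤ R j ∧ ε k ≤ a j := by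
  have hε0 : 0 ≤ ε 0 := hε.le_of_tendsto hlim 0
  -- The `+ 1` keeps `A` positive even if `ε` vanishes identically.
  set A := ε 0 + 1
  have hA : 0 < A := by positivity
  have hN (j : ℕ) : ∃ N : ℕ, ∀ k ≥ N, ε k ≤ A * (1 / 2) ^ j :=
    eventually_atTop.1 (hlim.eventually_le_const (by positivity))
  choose N hN using hN
  -- The least `j` with `k ≤ R j` works: if `j > 0`, then `k` exceeds `N (j - 1)`, and the factor
  -- `2` absorbs this index shift. The summand `j` makes `R` unbounded, so such a `j` exists.
  refine ⟨fun j => 2 * A * (1 / 2) ^ j, fun j => (N j + j + 1 : ℕ),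
    summable_geometric_two.mul_left _, fun j => by positivity, fun j => by positivity,
    fun k => ?_⟩
  have hex : ∃ j, k ≤ N j + j + 1 := ⟨k, by omega⟩
  classical
  refine ⟨Nat.find hex, Nat.cast_le.2 (Nat.find_spec hex), ?_⟩
  rcases hj : Nat.find hex with _ | i
  · have := hε (Nat.zero_le k)
    simp only [pow_zero, A]
    linarith
  · have hlt : ¬ k ≤ N i + i + 1 := Nat.find_min hex (by omega)
    have := hN i k (by omega)
    calc ε k ≤ A * (1 / 2) ^ i := this
      _ = 2 * A * (1 / 2) ^ (i + 1) := by ring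

theorem exists_even_mem_WienerW0Star_ge {ε : ℕ → ℝ} (hε : Antitone ε)
    (hlim : Tendsto ε atTop (𝓝 0)) :
    ∃ f : ℝ → ℝ, Function.Even f ∧ (fun x : ℝ => (f x : ℂ)) ∈ WienerW0Star ∧
      ∀ k : ℕ, ε k ≤ f k := by
  obtain ⟨a, R, ha, ha0, hR, hdom⟩ := exists_summable_dominating hε hlim
  -- The factor `e` offsets the value `exp (-1)` of the Gaussian at `|x| = R j`.
  let c : ℕ → ℝ := fun j => Real.exp 1 * a j
  let b : ℕ → ℝ := fun j => R j ^ 2 / 4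
  have hc : Summable c := ha.mul_left _
  have hc0 (j : ℕ) : 0 ≤ c j := mul_nonneg (Real.exp_pos 1).le (ha0 j)
  have hb (j : ℕ) : 0 < b j := div_pos (pow_pos (hR j) 2) four_pos
  have hnorm (j : ℕ) (y : ℝ) : ‖(gaussianKernel (c j) (b j) y : ℂ)‖ =
      gaussianKernel (c j) (b j) y :=
    Complex.norm_of_nonneg (gaussianKernel_nonneg (hc0 j) y)
  refine ⟨fun x => ∑' j, c j * Real.exp (-x ^ 2 / (4 * b j)), fun x => by simp, ?_, fun k => ?_⟩
  · simp only [Complex.ofReal_tsum]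
    refine tsum_mem_WienerW0Star (fun j => isFourierIntegralOf_gaussianKernel (hb j))
      (fun j => (integrable_gaussianKernel (hb j)).ofReal) ?_ fun j t s hts => ?_
    · simpa only [hnorm, integral_gaussianKernel (hb _)] using hc
    · simpa only [hnorm] using gaussianKernel_le_of_abs_le (hc0 j) (hb j) hts
  · have hsum : Summable fun j => c j * Real.exp (-(k : ℝ) ^ 2 / (4 * b j)) := by
      refine hc.of_nonneg_of_le (fun j => mul_nonneg (hc0 j) (Real.exp_pos _).le) fun j =>
        mul_le_of_le_one_right (hc0 j) (Real.exp_le_one_iff.2 ?_)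
      exact div_nonpos_of_nonpos_of_nonneg (neg_nonpos.2 (sq_nonneg _)) (by linarith [hb j])
    obtain ⟨j, hkj, hj⟩ := hdom k
    have hexp : Real.exp (-1) ≤ Real.exp (-(k : ℝ) ^ 2 / (4 * b j)) := by
      refine Real.exp_le_exp.2 ?_
      rw [le_div_iff₀ (by linarith [hb j])]
      have : (k : ℝ) ^ 2 ≤ R j ^ 2 := pow_le_pow_left₀ (Nat.cast_nonneg k) hkj 2
      simp only [b]
      linarith
    calc ε k ≤ a j := hj
      _ = c j * Real.exp (-1) := by
          simp only [c]
          rw [mul_right_comm, ← Real.exp_add]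
          simp
      _ ≤ c j * Real.exp (-(k : ℝ) ^ 2 / (4 * b j)) := mul_le_mul_of_nonneg_left hexp (hc0 j)
      _ ≤ _ := hsum.le_tsum j fun i _ => mul_nonneg (hc0 i) (Real.exp_pos _).le

theorem mainTheorem7 :
    (∀ f ∈ WienerW0, ∃ g : ℝ → ℝ,
      Function.Even g ∧ StrictMonoOn g (Ici 0) ∧ Tendsto g atTop atTop ∧
      (fun x : ℝ => (g x : ℂ) * f x) ∈ WienerW0) ∧
    (∀ ε : ℕ → ℝ, Antitone ε → Tendsto ε atTop (𝓝 0) →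
      ∃ f : ℝ → ℝ, Function.Even f ∧ (fun x : ℝ => (f x : ℂ)) ∈ WienerW0Star ∧
        ∀ k : ℕ, ε k ≤ f k) :=
  ⟨fun _ hf => exists_even_strictMonoOn_mul_mem_WienerW0 hf,
    fun _ hε hlim => exists_even_mem_WienerW0Star_ge hε hlim⟩
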